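/- For integers $n,m\ge 0$ let $R^T(n,m)$ be the 3.12.12 lattice with toroidal boundary condition, on $6(m+1)(n+1)$ vertices: there are two triangles $X_{i,j}$ and $Y_{i,j}$ for each $i\in\mathbb Z/(m+1)$, $j\in\mathbb Z/(n+1)$, the three vertices of $X_{i,j}$ are $x^0_{i,j},x^1_{i,j},x^2_{i,j}$, those of $Y_{i,j}$ are $y^0_{i,j},y^1_{i,j},y^2_{i,j}$, and besides the edges of the triangles there are the edges $y^0_{i,j}x^0_{i,j}$, $y^1_{i,j}x^1_{i,j+1}$ and $y^2_{i,j}x^2_{i+1,j}$ for all $i,j$ (so contracting every triangle gives the hexagonal lattice on the torus). Let $R^C(n,m)$, with cylindrical boundary condition, be obtained from $R^T(n,m)$ by deleting the $n+1$ edges $y^2_{m,j}x^2_{0,j}$ $(0\le j\le n)$, and let $R^F(n,m)$, with free boundary condition, be obtained from $R^C(n,m)$ by deleting the $m+1$ edges $y^1_{i,n}x^1_{i,0}$ $(0\le i\le m)$. Let $M(G)$ denote the number of perfect matchings of a graph $G$. Then, for all $n,m\ge 0$, $$M(R^T(n,m))=2^{mn+m+n+2},\qquad M(R^C(n,m))=2^{mn+m+1},\qquad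 M(R^F(n,m))=2^{mn}.$$ Moreover, each of the three families has entropy $\frac13\ln 2$, that is, for $R=R^T,R^C,R^F$, $$\lim_{n,m\to\infty}\frac{2\ln M(R(n,m))}{6(m+1)(n+1)}=\frac13\ln 2 .$$ -/

import Mathlib

open Filter Topology

/-- The number `M(G)` of perfect matchings of a graph. -/
noncomputable def numPerfectMatchings {V : Type*} (G : SimpleGraph V) : ℕ :=
  Set.ncard {M : G.Subgraph | M.IsPerfectMatching}

/-- The doubly indexed family of graphs `G n m` has entropy `h`: with `ν` the number of vertices,
`2 * log M(G n m) / ν` tends to `h` as `n` and `m` tend to infinity (independently). -/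
def HasEntropy {V : ℕ → ℕ → Type*} (G : ∀ n m, SimpleGraph (V n m)) (h : ℝ) : Prop :=
  Tendsto (fun p : ℕ × ℕ =>
      2 * Real.log (numPerfectMatchings (G p.1 p.2) : ℝ) / (Nat.card (V p.1 p.2) : ℝ))
    (atTop ×ˢ atTop) (𝓝 h)

namespace TwelveTwelve

/-- The vertices of the lattices with `m + 1` rows and `n + 1` columns of unit cells.
Each cell `(i, j)` (row `i`, column `j`) contains two triangles, the first one (`false`) and the
second one (`true`), one for each of the two sites of the hexagonal lattice in that cell. The
three corners of a triangle are labelled by the three bond directions: each corner is an end of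
the bond in that direction. -/
abbrev Vertex (n m : ℕ) : Type := (Fin (m + 1) × Fin (n + 1)) × Bool × Fin 3

/-- The cell reached from the second triangle of a cell along the bond in a direction: direction
`0` stays in the cell, direction `1` goes to the next column, direction `2` to the next row.
Addition in `Fin (k + 1)` is modulo `k + 1`, so rows and columns are closed up cyclically. -/
def next {n m : ℕ} (d : Fin 3) (c : Fin (m + 1) × Fin (n + 1)) : Fin (m + 1) × Fin (n + 1) :=
  match d with
  | 0 => c
  | 1 => (c.1, c.2 + 1)
  | 2 => (c.1 + 1, c.2)

/-- `u` and `v` are two corners of the same triangle (equal corners are discarded below). -/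
def SameTriangle {n m : ℕ} (u v : Vertex n m) : Prop :=
  u.1 = v.1 ∧ u.2.1 = v.2.1

/-- `u` and `v` are the ends of a bond, from a second triangle `u` to a first triangle `v`. -/
def Bond {n m : ℕ} (u v : Vertex n m) : Prop :=
  u.2.1 = true ∧ v.2.1 = false ∧ u.2.2 = v.2.2 ∧ v.1 = next u.2.2 u.1

/-- The 3.12.12 lattice with toroidal boundary condition. -/
def RT (n m : ℕ) : SimpleGraph (Vertex n m) :=
  SimpleGraph.fromRel fun u v => SameTriangle u v ∨ Bond u v

/-- The left boundary vertex of row `i`. -/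
def a {n m : ℕ} (i : Fin (m + 1)) : Vertex n m := ((i, 0), false, 1)

/-- The right boundary vertex of row `i`. -/
def aStar {n m : ℕ} (i : Fin (m + 1)) : Vertex n m := ((i, Fin.last n), true, 1)

/-- The boundary vertex of column `j` in the first row. -/
def b {n m : ℕ} (j : Fin (n + 1)) : Vertex n m := ((0, j), false, 2)

/-- The boundary vertex of column `j` in the last row. -/
def bStar {n m : ℕ} (j : Fin (n + 1)) : Vertex n m := ((Fin.last m, j), true, 2)

/-- The 3.12.12 lattice with cylindrical boundary condition: the `n + 1` edges that join the last
row to the first row are deleted. -/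
def RC (n m : ℕ) : SimpleGraph (Vertex n m) :=
  (RT n m).deleteEdges (Set.range fun j : Fin (n + 1) => s(b j, bStar j))

/-- The 3.12.12 lattice with free boundary condition: in addition, the `m + 1` edges that join the
last column to the first column are deleted. -/
def RF (n m : ℕ) : SimpleGraph (Vertex n m) :=
  (RC n m).deleteEdges (Set.range fun i : Fin (m + 1) => s(a i, aStar i))

end TwelveTwelve

/-! Contract every triangle of such a lattice. A perfect matching of the lattice uses an odd number
of the three bonds at each triangle, since a triangle has three corners; conversely a set of bonds
that is odd at every triangle extends to a unique perfect matching, by the side of each triangle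
that joins the two corners left over, if any. Over `𝔽₂` such sets of bonds are the solutions of
`∂ f = 1`, where `∂` is the boundary map of the contracted multigraph. As this is
connected, the image of `∂` is the hyperplane of vectors with sum zero. It contains the vector `1`
as the number of triangles is even, so that there are `2 ^ (bonds - triangles + 1)` solutions. -/

section Boundary

variable {E S S' : Type*} [Fintype E] [DecidableEq S] [DecidableEq S']

/-- The sum modulo `2` of the indicator functions of the two endpoints of an edge; it is zero for a
loop. -/
def endpointSum : Sym2 S → S → ZMod 2 :=
  Sym2.lift ⟨fun s t => Pi.single s 1 + Pi.single t 1, fun _ _ => add_comm _ _⟩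

theorem endpointSum_mk (s t : S) : endpointSum s(s, t) = Pi.single s 1 + Pi.single t 1 := rfl

theorem endpointSum_mk_eq_sub (s t : S) :
    endpointSum s(s, t) = Pi.single s 1 - Pi.single t 1 := by
  funext x
  simp only [endpointSum_mk, Pi.add_apply, Pi.sub_apply, CharTwo.sub_eq_add]

theorem endpointSum_apply_of_mem {e : Sym2 S} (he : ¬e.IsDiag) {s : S} (hs : s ∈ e) :
    endpointSum e s = 1 := by
  obtain ⟨t, rfl⟩ := hs
  have hne : s ≠ t := he
  simp [endpointSum_mk, hne]

theorem endpointSum_apply_of_notMem {e : Sym2 S} {s : S} (hs : s ∉ e) : endpointSum e s = 0 := by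
  induction e with
  | h t u =>
    obtain ⟨ht, hu⟩ : s ≠ t ∧ s ≠ u := by simpa using hs
    simp [endpointSum_mk, ht, hu]

theorem sum_endpointSum [Fintype S] (e : Sym2 S) : ∑ s, endpointSum e s = 0 := by
  induction e with
  | h s t => simp [endpointSum_mk, Finset.sum_add_distrib, CharTwo.add_self_eq_zero]

theorem endpointSum_map [Fintype S] (π : S → S') (e : Sym2 S) (t : S') :
    endpointSum (e.map π) t = ∑ s with π s = t, endpointSum e s := by
  induction e with
  | h u v =>
    simp [endpointSum_mk, Finset.sum_add_distrib, Pi.single_apply, eq_comm]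

/-- The boundary map modulo `2` of the multigraph on `S` whose edges are indexed by `E`, the edge
`e` having the endpoints `ends e`. -/
def boundary (ends : E → Sym2 S) : (E → ZMod 2) →ₗ[ZMod 2] S → ZMod 2 :=
  Fintype.linearCombination (ZMod 2) fun e => endpointSum (ends e)

theorem boundary_apply (ends : E → Sym2 S) (f : E → ZMod 2) (s : S) :
    boundary ends f s = ∑ e, f e * endpointSum (ends e) s := by
  simp [boundary, Fintype.linearCombination_apply]

theorem boundary_map [Fintype S] (π : S → S') (ends : E → Sym2 S) (f : E → ZMod 2) (t : S') :
    boundary (fun e => (ends e).map π) f t = ∑ s with π s = t, boundary ends f s := by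
  simp only [boundary_apply, endpointSum_map, Finset.mul_sum]
  exact Finset.sum_comm

theorem endpointSum_mem_range_boundary (ends : E → Sym2 S) (e : E) :
    endpointSum (ends e) ∈ LinearMap.range (boundary ends) := by
  classical
  exact ⟨Pi.single e 1, by simp [boundary]⟩

theorem single_sub_single_mem_range_boundary {ends : E → Sym2 S} {s t : S}
    (h : (SimpleGraph.fromEdgeSet (Set.range ends)).Reachable s t) :
    (Pi.single s 1 - Pi.single t 1 : S → ZMod 2) ∈ LinearMap.range (boundary ends) := by
  obtain ⟨p⟩ := h
  induction p with
  | nil => simp only [sub_self, zero_mem]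
  | cons hadj _ ih =>
    obtain ⟨⟨e, he⟩, -⟩ := (SimpleGraph.fromEdgeSet_adj _).1 hadj
    rw [← sub_add_sub_cancel, ← endpointSum_mk_eq_sub, ← he]
    exact add_mem (endpointSum_mem_range_boundary ends e) ih

variable [Fintype S]

theorem range_boundary {ends : E → Sym2 S}
    (h : (SimpleGraph.fromEdgeSet (Set.range ends)).Connected) :
    LinearMap.range (boundary ends) =
      LinearMap.ker (Fintype.linearCombination (ZMod 2) (1 : S → ZMod 2)) := by
  refine le_antisymm ?_ fun T hT => ?_
  · rintro _ ⟨f, rfl⟩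
    simp only [LinearMap.mem_ker, Fintype.linearCombination_apply, Pi.one_apply, smul_eq_mul,
      mul_one, boundary_apply]
    rw [Finset.sum_comm]
    simp [← Finset.mul_sum, sum_endpointSum]
  · obtain ⟨r⟩ := h.nonempty
    have hT' : ∑ s, T s = 0 := by simpa [Fintype.linearCombination_apply] using hT
    have hsum : T = ∑ s, T s • (Pi.single s 1 - Pi.single r 1 : S → ZMod 2) := by
      simp only [smul_sub, Finset.sum_sub_distrib, ← Finset.sum_smul, hT', zero_smul, sub_zero]
      exact pi_eq_sum_univ' T
    rw [hsum]
    exact sum_mem fun s _ =>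
      Submodule.smul_mem _ _ (single_sub_single_mem_range_boundary (h.preconnected s r))

theorem finrank_ker_boundary {ends : E → Sym2 S}
    (h : (SimpleGraph.fromEdgeSet (Set.range ends)).Connected) :
    Module.finrank (ZMod 2) (LinearMap.ker (boundary ends)) + Fintype.card S =
      Fintype.card E + 1 := by
  have hsurj : Function.Surjective (Fintype.linearCombination (ZMod 2) (1 : S → ZMod 2)) := by
    obtain ⟨r⟩ := h.nonempty
    exact fun x => ⟨Pi.single r x, by simp⟩
  have hboundary := LinearMap.finrank_range_add_finrank_ker (boundary ends)
  have hsum := LinearMap.finrank_range_add_finrank_ker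
    (Fintype.linearCombination (ZMod 2) (1 : S → ZMod 2))
  rw [range_boundary h, Module.finrank_pi] at hboundary
  rw [LinearMap.range_eq_top.2 hsurj, finrank_top, Module.finrank_self, Module.finrank_pi] at hsum
  omega

theorem ncard_boundary_fiber {ends : E → Sym2 S}
    (h : (SimpleGraph.fromEdgeSet (Set.range ends)).Connected) {T : S → ZMod 2}
    (hT : ∑ s, T s = 0) :
    {f | boundary ends f = T}.ncard * 2 ^ Fintype.card S = 2 ^ (Fintype.card E + 1) := by
  obtain ⟨f₀, rfl⟩ : T ∈ LinearMap.range (boundary ends) := by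
    rw [range_boundary h]
    simpa [Fintype.linearCombination_apply] using hT
  have hcoset : {f | boundary ends f = boundary ends f₀} =
      (f₀ + ·) '' (LinearMap.ker (boundary ends) : Set (E → ZMod 2)) := by
    ext f
    simp [← sub_eq_neg_add, sub_eq_zero]
  rw [hcoset, Set.ncard_image_of_injective _ (add_right_injective f₀), ← Nat.card_coe_set_eq,
    SetLike.coe_sort_coe, Module.natCard_eq_pow_finrank (K := ZMod 2), Nat.card_zmod, ← pow_add,
    finrank_ker_boundary h]

end Boundary

section TriangleInflation

variable {V S : Type*} {G : SimpleGraph V} {π : V → S}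

/-- `G` is obtained from a multigraph on `S` by replacing every vertex `s` by a triangle, namely the
fiber of `π` over `s`, each corner of which inherits at most one edge of the multigraph. -/
structure IsTriangleInflation (G : SimpleGraph V) (π : V → S) : Prop where
  ncard_fiber (s : S) : {v | π v = s}.ncard = 3
  adj_of_map_eq {u v : V} : u ≠ v → π u = π v → G.Adj u v
  eq_of_adj_of_map_ne {u v w : V} :
    G.Adj u v → π u ≠ π v → G.Adj u w → π u ≠ π w → v = w

/-- The edges of `G` that join different fibers of `π`: the edges of the multigraph of which `G` is
a triangle inflation. -/
def bonds (G : SimpleGraph V) (π : V → S) : Set (Sym2 V) :=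
  {e ∈ G.edgeSet | ¬(e.map π).IsDiag}

theorem mk_mem_bonds {u v : V} : s(u, v) ∈ bonds G π ↔ G.Adj u v ∧ π u ≠ π v := Iff.rfl

theorem bonds_deleteEdges (D : Set (Sym2 V)) :
    bonds (G.deleteEdges D) π = bonds G π \ D := by
  ext e
  simp only [bonds, SimpleGraph.edgeSet_deleteEdges, Set.mem_sdiff, Set.mem_ofPred_eq]
  tauto

/-- The multigraph is given by the family of its edges, as it may have parallel edges. -/
theorem connected_fromEdgeSet_range_bonds (hG : G.Connected) (hπ : Function.Surjective π) :
    (SimpleGraph.fromEdgeSet (Set.range fun e : bonds G π => e.1.map π)).Connected := by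
  have := hG.nonempty.map π
  refine ⟨fun s t => ?_⟩
  obtain ⟨u, rfl⟩ := hπ s
  obtain ⟨v, rfl⟩ := hπ t
  obtain ⟨p⟩ := hG.preconnected u v
  induction p with
  | nil => rfl
  | @cons u w _ hadj _ ih =>
    refine SimpleGraph.Reachable.trans ?_ ih
    by_cases h : π u = π w
    · rw [h]
    · exact SimpleGraph.Adj.reachable
        ((SimpleGraph.fromEdgeSet_adj _).2 ⟨⟨⟨s(u, w), hadj, h⟩, rfl⟩, h⟩)

/-- The indicator function of the set of bonds that belong to a subgraph. -/
noncomputable def bondIndicator (M : G.Subgraph) : bonds G π → ZMod 2 :=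
  Set.indicator {e | e.1 ∈ M.edgeSet} 1

theorem bondIndicator_eq_one_iff {M : G.Subgraph} {e : bonds G π} :
    bondIndicator M e = 1 ↔ e.1 ∈ M.edgeSet := by
  simp only [bondIndicator, Set.indicator_eq_one_iff_mem]
  rfl

namespace IsTriangleInflation

theorem surjective (hG : IsTriangleInflation G π) : Function.Surjective π := fun s =>
  Set.nonempty_of_ncard_ne_zero (hG.ncard_fiber s ▸ three_ne_zero)

theorem deleteEdges (hG : IsTriangleInflation G π) {D : Set (Sym2 V)} (hD : D ⊆ bonds G π) :
    IsTriangleInflation (G.deleteEdges D) π where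
  ncard_fiber := hG.ncard_fiber
  adj_of_map_eq huv h :=
    (G.deleteEdges_adj).2 ⟨hG.adj_of_map_eq huv h, fun hmem => (mk_mem_bonds.1 (hD hmem)).2 h⟩
  eq_of_adj_of_map_ne hv hπv hw hπw :=
    hG.eq_of_adj_of_map_ne (G.deleteEdges_le D hv) hπv (G.deleteEdges_le D hw) hπw

theorem reachable_of_map_eq (hG : IsTriangleInflation G π) {u v : V} (h : π u = π v) :
    G.Reachable u v := by
  obtain rfl | huv := eq_or_ne u v
  · rfl
  · exact (hG.adj_of_map_eq huv h).reachable

theorem bond_eq_of_mem (hG : IsTriangleInflation G π) {e e' : Sym2 V} (he : e ∈ bonds G π)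
    (he' : e' ∈ bonds G π) {v : V} (hv : v ∈ e) (hv' : v ∈ e') : e = e' := by
  obtain ⟨u, rfl⟩ := hv
  obtain ⟨w, rfl⟩ := hv'
  exact congrArg _ (hG.eq_of_adj_of_map_ne he.1 he.2 he'.1 he'.2)

variable [Fintype V] [DecidableEq S]

theorem card_fiber (hG : IsTriangleInflation G π) (s : S) :
    ({v | π v = s} : Finset V).card = 3 := by
  rw [← hG.ncard_fiber s, Set.ncard_eq_toFinset_card', Set.toFinset_ofPred]

variable [DecidableEq V]

theorem exists_fiber_eq (hG : IsTriangleInflation G π) (v : V) :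
    ∃ a b, v ≠ a ∧ v ≠ b ∧ a ≠ b ∧ ({x | π x = π v} : Finset V) = {v, a, b} := by
  have hv : v ∈ ({x | π x = π v} : Finset V) := by simp
  obtain ⟨a, b, hab, h⟩ := Finset.card_eq_two.1
    ((Finset.card_erase_of_mem hv).trans (by rw [hG.card_fiber]))
  have hnotMem : v ∉ ({a, b} : Finset V) := h ▸ Finset.notMem_erase v _
  rw [Finset.mem_insert, Finset.mem_singleton, not_or] at hnotMem
  exact ⟨a, b, hnotMem.1, hnotMem.2, hab, by rw [← h, Finset.insert_erase hv]⟩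

theorem exists_fiber_eq_of_map_eq (hG : IsTriangleInflation G π) {u v : V} (huv : u ≠ v)
    (h : π u = π v) :
    ∃ w, u ≠ w ∧ v ≠ w ∧ ({x | π x = π u} : Finset V) = {u, v, w} := by
  obtain ⟨a, b, hua, hub, hab, hfiber⟩ := hG.exists_fiber_eq u
  have hv : v ∈ ({u, a, b} : Finset V) := by simp [← hfiber, h]
  obtain rfl | rfl | rfl : v = u ∨ v = a ∨ v = b := by simpa using hv
  · exact absurd rfl huv
  · exact ⟨b, hub, hab, hfiber⟩
  · exact ⟨a, hua, hab.symm, by rw [hfiber, Finset.pair_comm]⟩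

end IsTriangleInflation

variable [DecidableEq V] [Fintype (bonds G π)]

/-- The number modulo `2` of the bonds at a vertex that belong to a set of bonds, which is given by
its indicator function. -/
def flux (f : bonds G π → ZMod 2) : V → ZMod 2 := boundary Subtype.val f

theorem flux_eq_of_mem (hG : IsTriangleInflation G π) (f : bonds G π → ZMod 2) {e : bonds G π}
    {v : V} (hv : v ∈ e.1) : flux f v = f e := by
  have he : ¬e.1.IsDiag := G.not_isDiag_of_mem_edgeSet e.2.1
  rw [flux, boundary_apply, Finset.sum_eq_single e, endpointSum_apply_of_mem he hv, mul_one]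
  · intro e' _ hne
    have hv' : v ∉ e'.1 := fun hv' => hne (Subtype.ext (hG.bond_eq_of_mem e'.2 e.2 hv' hv))
    rw [endpointSum_apply_of_notMem hv', mul_zero]
  · exact fun h => absurd (Finset.mem_univ e) h

theorem flux_eq_zero_of_forall_notMem (f : bonds G π → ZMod 2) {v : V}
    (hv : ∀ e : bonds G π, v ∉ e.1) : flux f v = 0 := by
  simp only [flux, boundary_apply, endpointSum_apply_of_notMem (hv _), mul_zero,
    Finset.sum_const_zero]

theorem flux_eq_one_iff (hG : IsTriangleInflation G π) (f : bonds G π → ZMod 2) (v : V) :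
    flux f v = 1 ↔ ∃ w, ∃ h : s(v, w) ∈ bonds G π, f ⟨s(v, w), h⟩ = 1 := by
  constructor
  · intro h
    obtain ⟨⟨e, he⟩, hv⟩ : ∃ e : bonds G π, v ∈ e.1 := by
      by_contra! hv
      exact zero_ne_one ((flux_eq_zero_of_forall_notMem f hv).symm.trans h)
    obtain ⟨w, rfl⟩ := id hv
    exact ⟨w, he, by rw [← h, flux_eq_of_mem hG f hv]⟩
  · rintro ⟨w, h, hf⟩
    rw [← hf, flux_eq_of_mem hG f (e := ⟨s(v, w), h⟩) (Sym2.mem_mk_left v w)]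

/-- The subgraph that consists of a set of bonds and of the sides of triangles not meeting it. -/
def matchingOf (f : bonds G π → ZMod 2) : G.Subgraph where
  verts := Set.univ
  Adj u v := G.Adj u v ∧
    (π u = π v ∧ flux f u = 0 ∧ flux f v = 0 ∨ π u ≠ π v ∧ flux f u = 1 ∧ flux f v = 1)
  adj_sub h := h.1
  edge_vert _ := Set.mem_univ _
  symm := ⟨by
    rintro u v ⟨hadj, ⟨h, hu, hv⟩ | ⟨h, hu, hv⟩⟩
    · exact ⟨hadj.symm, Or.inl ⟨h.symm, hv, hu⟩⟩
    · exact ⟨hadj.symm, Or.inr ⟨h.symm, hv, hu⟩⟩⟩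

theorem flux_bondIndicator_eq_one_iff (hG : IsTriangleInflation G π) {M : G.Subgraph} {v : V} :
    flux (π := π) (bondIndicator M) v = 1 ↔ ∃ w, M.Adj v w ∧ π v ≠ π w := by
  simp only [flux_eq_one_iff hG, bondIndicator_eq_one_iff, SimpleGraph.Subgraph.mem_edgeSet,
    mk_mem_bonds]
  exact exists_congr fun w => ⟨fun ⟨h, hM⟩ => ⟨hM, h.2⟩, fun ⟨hM, h⟩ => ⟨⟨hM.adj_sub, h⟩, hM⟩⟩

theorem bondIndicator_matchingOf (hG : IsTriangleInflation G π) (f : bonds G π → ZMod 2) :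
    bondIndicator (matchingOf f) = f := by
  funext ⟨e, he⟩
  have eq_of_eq_one_iff : ∀ x y : ZMod 2, (x = 1 ↔ y = 1) → x = y := by decide
  refine eq_of_eq_one_iff _ _ (bondIndicator_eq_one_iff.trans ?_)
  induction e with
  | h u v =>
    have hu := flux_eq_of_mem hG f (e := ⟨s(u, v), he⟩) (Sym2.mem_mk_left u v)
    have hv := flux_eq_of_mem hG f (e := ⟨s(u, v), he⟩) (Sym2.mem_mk_right u v)
    obtain ⟨hadj, h⟩ := mk_mem_bonds.1 he
    simp [matchingOf, hadj, h, hu, hv]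

theorem le_matchingOf_bondIndicator (hG : IsTriangleInflation G π) {M : G.Subgraph}
    (hM : M.IsPerfectMatching) : M ≤ matchingOf (bondIndicator (π := π) M) := by
  have ne_one_iff : ∀ x : ZMod 2, x ≠ 1 ↔ x = 0 := by decide
  refine ⟨Set.subset_univ _, fun u v huv => ⟨huv.adj_sub, ?_⟩⟩
  by_cases h : π u = π v
  · refine Or.inl ⟨h, ?_, ?_⟩
    · rw [← ne_one_iff, Ne, flux_bondIndicator_eq_one_iff hG]
      rintro ⟨w, huw, hne⟩
      exact hne (hM.1.eq_of_adj_left huv huw ▸ h)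
    · rw [← ne_one_iff, Ne, flux_bondIndicator_eq_one_iff hG]
      rintro ⟨w, hvw, hne⟩
      exact hne (hM.1.eq_of_adj_left huv.symm hvw ▸ h.symm)
  · exact Or.inr ⟨h, (flux_bondIndicator_eq_one_iff hG).2 ⟨v, huv, h⟩,
      (flux_bondIndicator_eq_one_iff hG).2 ⟨u, huv.symm, Ne.symm h⟩⟩

theorem existsUnique_matchingOf_adj_of_flux_eq_one (hG : IsTriangleInflation G π)
    {f : bonds G π → ZMod 2} {v : V} (hv : flux f v = 1) : ∃! w, (matchingOf f).Adj v w := by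
  obtain ⟨w, hw, hfw⟩ := (flux_eq_one_iff hG f v).1 hv
  have hw1 : flux f w = 1 :=
    (flux_eq_of_mem hG f (e := ⟨s(v, w), hw⟩) (Sym2.mem_mk_right v w)).trans hfw
  refine ⟨w, ⟨hw.1, Or.inr ⟨hw.2, hv, hw1⟩⟩, ?_⟩
  rintro y ⟨hadj, ⟨-, hv0, -⟩ | ⟨hy, -, -⟩⟩
  · exact absurd (hv0.symm.trans hv) zero_ne_one
  · exact hG.eq_of_adj_of_map_ne hadj hy hw.1 hw.2

variable [Fintype V] [DecidableEq S]

theorem existsUnique_matchingOf_adj_of_flux_eq_zero (hG : IsTriangleInflation G π)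
    {f : bonds G π → ZMod 2} {v a b : V} (hva : v ≠ a)
    (hfiber : ({x | π x = π v} : Finset V) = {v, a, b}) (hv : flux f v = 0) (ha : flux f a = 0)
    (hb : flux f b = 1) : ∃! w, (matchingOf f).Adj v w := by
  have mem_fiber : ∀ x, π x = π v ↔ x = v ∨ x = a ∨ x = b := by
    simpa [Finset.ext_iff] using hfiber
  have hπ : π v = π a := ((mem_fiber a).2 (by simp)).symm
  refine ⟨a, ⟨hG.adj_of_map_eq hva hπ, Or.inl ⟨hπ, hv, ha⟩⟩, ?_⟩
  rintro w ⟨hadj, ⟨hw, -, hw0⟩ | ⟨-, hv1, -⟩⟩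
  · obtain rfl | rfl | rfl := (mem_fiber w).1 hw.symm
    · exact absurd rfl hadj.ne
    · rfl
    · exact absurd (hw0.symm.trans hb) zero_ne_one
  · exact absurd (hv.symm.trans hv1) zero_ne_one

theorem matchingOf_isPerfectMatching (hG : IsTriangleInflation G π) {f : bonds G π → ZMod 2}
    (hf : ∀ s, ∑ v with π v = s, flux f v = 1) : (matchingOf f).IsPerfectMatching := by
  rw [SimpleGraph.Subgraph.isPerfectMatching_iff]
  intro v
  have eq_zero_or_one : ∀ x : ZMod 2, x = 0 ∨ x = 1 := by decide
  have add_eq_one : ∀ x y : ZMod 2, x + y = 1 → x = 0 ∧ y = 1 ∨ x = 1 ∧ y = 0 := by decide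
  obtain hv | hv := eq_zero_or_one (flux f v)
  · obtain ⟨a, b, hva, hvb, hab, hfiber⟩ := hG.exists_fiber_eq v
    have hsum : flux f a + flux f b = 1 := by
      simpa [hfiber, hva, hvb, hab, hv] using hf (π v)
    obtain ⟨ha, hb⟩ | ⟨ha, hb⟩ := add_eq_one _ _ hsum
    · exact existsUnique_matchingOf_adj_of_flux_eq_zero hG hva hfiber hv ha hb
    · rw [Finset.pair_comm] at hfiber
      exact existsUnique_matchingOf_adj_of_flux_eq_zero hG hvb hfiber hv hb ha
  · exact existsUnique_matchingOf_adj_of_flux_eq_one hG hv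

theorem sum_fiber_flux_bondIndicator (hG : IsTriangleInflation G π) {M : G.Subgraph}
    (hM : M.IsPerfectMatching) (s : S) :
    ∑ v with π v = s, flux (π := π) (bondIndicator M) v = 1 := by
  have exists_adj := fun v => (SimpleGraph.Subgraph.isPerfectMatching_iff.1 hM v).exists
  by_cases hside : ∃ u v, M.Adj u v ∧ π u = s ∧ π v = s
  · obtain ⟨u, v, huv, rfl, hv⟩ := hside
    obtain ⟨-, ⟨-, hu0, hv0⟩ | ⟨h, -, -⟩⟩ := (le_matchingOf_bondIndicator hG hM).2 huv
    · obtain ⟨w, huw, hvw, hfiber⟩ := hG.exists_fiber_eq_of_map_eq huv.adj_sub.ne hv.symm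
      have hw1 : flux (π := π) (bondIndicator M) w = 1 := by
        obtain ⟨x, hwx⟩ := exists_adj w
        refine (flux_bondIndicator_eq_one_iff hG).2 ⟨x, hwx, fun hx => ?_⟩
        have mem_fiber : ∀ x, π x = π u ↔ x = u ∨ x = v ∨ x = w := by
          simpa [Finset.ext_iff] using hfiber
        obtain rfl | rfl | rfl := (mem_fiber x).1 (hx.symm.trans ((mem_fiber w).2 (by simp)))
        · exact hvw (hM.1.eq_of_adj_left huv hwx.symm)
        · exact huw (hM.1.eq_of_adj_right huv hwx)
        · exact hwx.adj_sub.ne rfl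
      rw [hfiber]
      simp [huw, hvw, huv.adj_sub.ne, hu0, hv0, hw1]
    · exact absurd hv.symm h
  · have hflux : ∀ v ∈ ({v | π v = s} : Finset V), flux (π := π) (bondIndicator M) v = 1 := by
      intro v hv
      obtain ⟨w, hvw⟩ := exists_adj v
      have hv : π v = s := by simpa using hv
      exact (flux_bondIndicator_eq_one_iff hG).2
        ⟨w, hvw, fun hw => hside ⟨v, w, hvw, hv, hw ▸ hv⟩⟩
    rw [Finset.sum_congr rfl hflux, Finset.sum_const, hG.card_fiber]
    rfl

end TriangleInflation

section Count

variable {V S : Type*} [Finite V] {G : SimpleGraph V} {π : V → S}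

theorem matchingOf_bondIndicator [DecidableEq V] [Fintype (bonds G π)]
    (hG : IsTriangleInflation G π) {M : G.Subgraph} (hM : M.IsPerfectMatching) :
    matchingOf (bondIndicator (π := π) M) = M := by
  classical
  have := Fintype.ofFinite V
  have hM' := matchingOf_isPerfectMatching hG (sum_fiber_flux_bondIndicator hG hM)
  have hle := le_matchingOf_bondIndicator hG hM
  refine SimpleGraph.Subgraph.ext hM.2.verts_eq_univ.symm ?_
  funext u v
  refine propext ⟨fun huv => ?_, fun huv => hle.2 huv⟩
  obtain ⟨w, huw⟩ := (SimpleGraph.Subgraph.isPerfectMatching_iff.1 hM u).exists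
  rwa [hM'.1.eq_of_adj_left huv (hle.2 huw)]

theorem bijOn_bondIndicator [DecidableEq S] [Fintype (bonds G π)]
    (hG : IsTriangleInflation G π) :
    Set.BijOn bondIndicator {M : G.Subgraph | M.IsPerfectMatching}
      {f | boundary (fun e : bonds G π => e.1.map π) f = 1} := by
  classical
  have := Fintype.ofFinite V
  have odd_iff : ∀ f, boundary (fun e : bonds G π => e.1.map π) f = 1 ↔
      ∀ s, ∑ v with π v = s, flux f v = 1 := fun f => by
    simp only [funext_iff, boundary_map, flux, Pi.one_apply]
  refine Set.BijOn.mk ?_ ?_ ?_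
  · exact fun M hM => (odd_iff _).2 (sum_fiber_flux_bondIndicator hG hM)
  · exact Set.LeftInvOn.injOn (f₁' := matchingOf) fun M hM => matchingOf_bondIndicator hG hM
  · exact fun f hf => ⟨matchingOf f, matchingOf_isPerfectMatching hG ((odd_iff f).1 hf),
      bondIndicator_matchingOf hG f⟩

theorem IsTriangleInflation.numPerfectMatchings_mul [Finite S] (hG : IsTriangleInflation G π)
    (hconn : G.Connected) (hS : Even (Nat.card S)) :
    numPerfectMatchings G * 2 ^ Nat.card S = 2 ^ ((bonds G π).ncard + 1) := by
  classical
  have := Fintype.ofFinite V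
  have := Fintype.ofFinite S
  have hone : ∑ s : S, (1 : S → ZMod 2) s = 0 := by
    rw [Nat.card_eq_fintype_card] at hS
    simpa using (ZMod.natCast_eq_zero_iff_even).2 hS
  have hcount := ncard_boundary_fiber (connected_fromEdgeSet_range_bonds hconn hG.surjective) hone
  rwa [numPerfectMatchings, (bijOn_bondIndicator hG).ncard_eq, Nat.card_eq_fintype_card,
    ← Nat.card_coe_set_eq (bonds G π), Nat.card_eq_fintype_card (α := bonds G π)]

theorem ncard_bonds_deleteEdges_add {D : Set (Sym2 V)} (hD : D ⊆ bonds G π) :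
    (bonds (G.deleteEdges D) π).ncard + D.ncard = (bonds G π).ncard := by
  rw [bonds_deleteEdges, Set.ncard_sdiff_add_ncard_of_subset hD]

end Count

namespace TwelveTwelve

section Lattice

variable {n m : ℕ}

/-- The triangle of a vertex, as a site of the hexagonal lattice. -/
def site (v : Vertex n m) : (Fin (m + 1) × Fin (n + 1)) × Bool := (v.1, v.2.1)

/-- The bond that starts at the second triangle of a cell in a given direction. -/
def latticeBond (p : (Fin (m + 1) × Fin (n + 1)) × Fin 3) : Sym2 (Vertex n m) :=
  s((p.1, true, p.2), (next p.2 p.1, false, p.2))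

theorem latticeBond_injective :
    Function.Injective (latticeBond : _ → Sym2 (Vertex n m)) := by
  rintro ⟨c, d⟩ ⟨c', d'⟩ h
  simp_all [latticeBond]

theorem next_injective (d : Fin 3) :
    Function.Injective (next d : _ → Fin (m + 1) × Fin (n + 1)) := by
  intro c c' h
  fin_cases d <;> simpa [next, Prod.ext_iff] using h

theorem RT_adj_of_site_eq {u v : Vertex n m} (huv : u ≠ v) (h : site u = site v) :
    (RT n m).Adj u v :=
  (SimpleGraph.fromRel_adj _ u v).2 ⟨huv, Or.inl (Or.inl (Prod.ext_iff.1 h))⟩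

theorem RT_adj_iff_of_site_ne {u v : Vertex n m} (h : site u ≠ site v) :
    (RT n m).Adj u v ↔ Bond u v ∨ Bond v u := by
  have huv : ¬SameTriangle u v := fun huv => h (Prod.ext huv.1 huv.2)
  have hvu : ¬SameTriangle v u := fun hvu => h (Prod.ext hvu.1.symm hvu.2.symm)
  have hne : u ≠ v := fun huv => h (congrArg site huv)
  simp [RT, huv, hvu, hne]

theorem Bond.mk_eq_latticeBond {u v : Vertex n m} (h : Bond u v) :
    s(u, v) = latticeBond (u.1, u.2.2) := by
  obtain ⟨c, s, d⟩ := u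
  obtain ⟨c', s', d'⟩ := v
  obtain ⟨rfl, rfl, rfl, rfl⟩ := h
  rfl

theorem bonds_RT : bonds (RT n m) site = Set.range latticeBond := by
  ext e
  induction e with
  | h u v =>
    rw [mk_mem_bonds]
    constructor
    · rintro ⟨hadj, h⟩
      obtain huv | hvu := (RT_adj_iff_of_site_ne h).1 hadj
      · exact ⟨_, huv.mk_eq_latticeBond.symm⟩
      · exact ⟨_, hvu.mk_eq_latticeBond.symm.trans Sym2.eq_swap⟩
    · rintro ⟨⟨c, d⟩, h⟩
      rw [← mk_mem_bonds, ← h, latticeBond, mk_mem_bonds]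
      have hne : site (c, true, d) ≠ site (next d c, false, d) := by simp [site]
      exact ⟨(RT_adj_iff_of_site_ne hne).2 (Or.inl ⟨rfl, rfl, rfl, rfl⟩), hne⟩

theorem RT_isTriangleInflation : IsTriangleInflation (RT n m) site where
  ncard_fiber := by
    rintro ⟨c, s⟩
    have hfiber : {v : Vertex n m | site v = (c, s)} = Set.range fun d => (c, s, d) := by
      ext ⟨c', s', d'⟩
      simp [site, eq_comm]
    rw [hfiber, Set.ncard_range_of_injective fun d d' h => by simpa using h, Nat.card_fin]
  adj_of_map_eq := RT_adj_of_site_eq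
  eq_of_adj_of_map_ne := by
    rintro ⟨c, s, d⟩ ⟨c', s', d'⟩ ⟨c'', s'', d''⟩ hv hπv hw hπw
    rw [RT_adj_iff_of_site_ne hπv] at hv
    rw [RT_adj_iff_of_site_ne hπw] at hw
    obtain ⟨rfl, rfl, rfl, rfl⟩ | ⟨rfl, rfl, rfl, rfl⟩ := hv <;>
      obtain ⟨h, rfl, rfl, hc⟩ | ⟨rfl, h, rfl, hc⟩ := hw
    · exact Prod.ext hc.symm rfl
    · exact absurd h Bool.noConfusion
    · exact absurd h Bool.noConfusion
    · exact Prod.ext (next_injective _ hc) rfl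

theorem mk_b_bStar (j : Fin (n + 1)) :
    s((b j : Vertex n m), bStar j) = latticeBond ((Fin.last m, j), 2) := by
  rw [Sym2.eq_swap, latticeBond, next, Fin.last_add_one]
  rfl

theorem mk_a_aStar (i : Fin (m + 1)) :
    s((a i : Vertex n m), aStar i) = latticeBond ((i, Fin.last n), 1) := by
  rw [Sym2.eq_swap, latticeBond, next, Fin.last_add_one]
  rfl

theorem range_b_bStar_subset_bonds_RT :
    (Set.range fun j : Fin (n + 1) => s(b j, bStar j)) ⊆ bonds (RT n m) site := by
  rw [bonds_RT]
  rintro _ ⟨j, rfl⟩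
  exact ⟨_, (mk_b_bStar j).symm⟩

theorem range_a_aStar_subset_bonds_RC :
    (Set.range fun i : Fin (m + 1) => s(a i, aStar i)) ⊆ bonds (RC n m) site := by
  rw [RC, bonds_deleteEdges, bonds_RT]
  rintro _ ⟨i, rfl⟩
  simp only [mk_a_aStar, mk_b_bStar]
  refine ⟨⟨_, rfl⟩, ?_⟩
  rintro ⟨j, h⟩
  simpa using latticeBond_injective h

theorem RC_isTriangleInflation : IsTriangleInflation (RC n m) site :=
  RT_isTriangleInflation.deleteEdges range_b_bStar_subset_bonds_RT

theorem RF_isTriangleInflation : IsTriangleInflation (RF n m) site :=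
  RC_isTriangleInflation.deleteEdges range_a_aStar_subset_bonds_RC

theorem ncard_bonds_RT : (bonds (RT n m) site).ncard = 3 * ((m + 1) * (n + 1)) := by
  rw [bonds_RT, Set.ncard_range_of_injective latticeBond_injective]
  simp [mul_comm]

theorem ncard_bonds_RC_add :
    (bonds (RC n m) site).ncard + (n + 1) = 3 * ((m + 1) * (n + 1)) := by
  have hinj : Function.Injective fun j : Fin (n + 1) => s((b j : Vertex n m), bStar j) := by
    intro j j' h
    simp only [mk_b_bStar] at h
    simpa using latticeBond_injective h
  rw [← ncard_bonds_RT, ← ncard_bonds_deleteEdges_add range_b_bStar_subset_bonds_RT,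
    Set.ncard_range_of_injective hinj, Nat.card_fin, RC]

theorem ncard_bonds_RF_add :
    (bonds (RF n m) site).ncard + (m + 1) = (bonds (RC n m) site).ncard := by
  have hinj : Function.Injective fun i : Fin (m + 1) => s((a i : Vertex n m), aStar i) := by
    intro i i' h
    simp only [mk_a_aStar] at h
    simpa using latticeBond_injective h
  rw [← ncard_bonds_deleteEdges_add range_a_aStar_subset_bonds_RC,
    Set.ncard_range_of_injective hinj, Nat.card_fin, RF]

theorem latticeBond_mem_bonds_RF {c : Fin (m + 1) × Fin (n + 1)} {d : Fin 3}
    (hcol : d = 1 → c.2 ≠ Fin.last n) (hrow : d = 2 → c.1 ≠ Fin.last m) :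
    latticeBond (c, d) ∈ bonds (RF n m) site := by
  simp only [RF, RC, bonds_deleteEdges, bonds_RT, mk_a_aStar, mk_b_bStar, Set.mem_sdiff,
    Set.mem_range_self, true_and, Set.mem_range, latticeBond_injective.eq_iff, not_exists]
  refine ⟨?_, ?_⟩
  · rintro j h
    obtain ⟨rfl, rfl⟩ := Prod.ext_iff.1 h
    exact hrow rfl rfl
  · rintro i h
    obtain ⟨rfl, rfl⟩ := Prod.ext_iff.1 h
    exact hcol rfl rfl

theorem RF_reachable_corner (c : Fin (m + 1) × Fin (n + 1)) (s : Bool) (d d' : Fin 3) :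
    (RF n m).Reachable (c, s, d) (c, s, d') :=
  RF_isTriangleInflation.reachable_of_map_eq rfl

theorem RF_adj_zero (c : Fin (m + 1) × Fin (n + 1)) :
    (RF n m).Adj (c, false, 0) (c, true, 0) :=
  (latticeBond_mem_bonds_RF (c := c) (d := 0) (by simp) (by simp)).1.symm

theorem RF_reachable_next {c : Fin (m + 1) × Fin (n + 1)} {d : Fin 3}
    (hcol : d = 1 → c.2 ≠ Fin.last n) (hrow : d = 2 → c.1 ≠ Fin.last m) :
    (RF n m).Reachable (c, false, 0) (next d c, false, 0) := by
  have hbond : (RF n m).Adj (c, true, d) (next d c, false, d) :=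
    (latticeBond_mem_bonds_RF hcol hrow).1
  exact (RF_adj_zero c).reachable.trans <| (RF_reachable_corner c true 0 d).trans <|
    hbond.reachable.trans <| RF_reachable_corner (next d c) false d 0

theorem RF_reachable_cell (c : Fin (m + 1) × Fin (n + 1)) :
    (RF n m).Reachable ((0, 0), false, 0) (c, false, 0) := by
  obtain ⟨i, j⟩ := c
  have hrow : (RF n m).Reachable ((0, 0), false, 0) ((i, 0), false, 0) := by
    induction i using Fin.induction with
    | zero => rfl
    | succ i ih =>
      have hstep := RF_reachable_next (c := (i.castSucc, (0 : Fin (n + 1)))) (d := 2)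
        (by simp) fun _ => i.castSucc_ne_last
      rw [next, Fin.coeSucc_eq_succ] at hstep
      exact ih.trans hstep
  refine hrow.trans ?_
  induction j using Fin.induction with
  | zero => rfl
  | succ j ih =>
    have hstep := RF_reachable_next (c := (i, j.castSucc)) (d := 1)
      (fun _ => j.castSucc_ne_last) (by simp)
    rw [next, Fin.coeSucc_eq_succ] at hstep
    exact ih.trans hstep

theorem RF_connected : (RF n m).Connected := by
  refine (SimpleGraph.connected_iff_exists_forall_reachable _).2 ⟨((0, 0), false, 0), ?_⟩
  rintro ⟨c, s, d⟩
  refine (RF_reachable_cell c).trans ?_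
  cases s with
  | false => exact RF_reachable_corner c false 0 d
  | true => exact (RF_adj_zero c).reachable.trans (RF_reachable_corner c true 0 d)

theorem RC_connected : (RC n m).Connected := RF_connected.mono (SimpleGraph.deleteEdges_le _)

theorem RT_connected : (RT n m).Connected := RC_connected.mono (SimpleGraph.deleteEdges_le _)

theorem numPerfectMatchings_eq_two_pow {G : SimpleGraph (Vertex n m)}
    (hG : IsTriangleInflation G site) (hconn : G.Connected) {k : ℕ}
    (hk : (bonds G site).ncard + 1 = k + 2 * ((m + 1) * (n + 1))) :
    numPerfectMatchings G = 2 ^ k := by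
  have hcard : Nat.card ((Fin (m + 1) × Fin (n + 1)) × Bool) = 2 * ((m + 1) * (n + 1)) := by
    simp [mul_comm]
  have hcount := hG.numPerfectMatchings_mul hconn (hcard ▸ even_two_mul _)
  rw [hcard, hk, pow_add] at hcount
  exact Nat.eq_of_mul_eq_mul_right (by positivity) hcount

theorem numPerfectMatchings_RT : numPerfectMatchings (RT n m) = 2 ^ (m * n + m + n + 2) := by
  refine numPerfectMatchings_eq_two_pow RT_isTriangleInflation RT_connected ?_
  linear_combination ncard_bonds_RT (n := n) (m := m)

theorem numPerfectMatchings_RC : numPerfectMatchings (RC n m) = 2 ^ (m * n + m + 1) := by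
  refine numPerfectMatchings_eq_two_pow RC_isTriangleInflation RC_connected ?_
  linarith [ncard_bonds_RC_add (n := n) (m := m)]

theorem numPerfectMatchings_RF : numPerfectMatchings (RF n m) = 2 ^ (m * n) := by
  refine numPerfectMatchings_eq_two_pow RF_isTriangleInflation RF_connected ?_
  linarith [ncard_bonds_RC_add (n := n) (m := m), ncard_bonds_RF_add (n := n) (m := m)]

end Lattice

theorem hasEntropy_of_eq_two_pow {G : ∀ n m, SimpleGraph (Vertex n m)} (A B C : ℕ)
    (h : ∀ n m, numPerfectMatchings (G n m) = 2 ^ (m * n + A * m + B * n + C)) :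
    HasEntropy G (1 / 3 * Real.log 2) := by
  have hcol : Tendsto (fun p : ℕ × ℕ => (p.1 : ℝ) / (p.1 + 1)) (atTop ×ˢ atTop) (𝓝 1) :=
    (tendsto_natCast_div_add_atTop 1).comp tendsto_fst
  have hrow : Tendsto (fun p : ℕ × ℕ => (p.2 : ℝ) / (p.2 + 1)) (atTop ×ˢ atTop) (𝓝 1) :=
    (tendsto_natCast_div_add_atTop 1).comp tendsto_snd
  have hcol' : Tendsto (fun p : ℕ × ℕ => 1 / ((p.1 : ℝ) + 1)) (atTop ×ˢ atTop) (𝓝 0) :=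
    tendsto_one_div_add_atTop_nhds_zero_nat.comp tendsto_fst
  have hrow' : Tendsto (fun p : ℕ × ℕ => 1 / ((p.2 : ℝ) + 1)) (atTop ×ˢ atTop) (𝓝 0) :=
    tendsto_one_div_add_atTop_nhds_zero_nat.comp tendsto_snd
  have hlim := (((hrow.mul hcol).add ((hrow.mul hcol').const_mul (A : ℝ))).add
    ((hrow'.mul hcol).const_mul (B : ℝ))).add ((hrow'.mul hcol').const_mul (C : ℝ))
    |>.const_mul (1 / 3 * Real.log 2)
  simp only [mul_zero, add_zero, mul_one] at hlim
  refine hlim.congr fun p => ?_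
  have hcard : (Nat.card (Vertex p.1 p.2) : ℝ) = 6 * (p.2 + 1) * (p.1 + 1) := by
    simp only [Nat.card_eq_fintype_card, Fintype.card_prod, Fintype.card_fin, Fintype.card_bool]
    push_cast
    ring
  rw [h, hcard]
  push_cast [Real.log_pow]
  field_simp
  ring

end TwelveTwelve

theorem theorem3p2 :
    (∀ n m : ℕ,
      numPerfectMatchings (TwelveTwelve.RT n m) = 2 ^ (m * n + m + n + 2) ∧
      numPerfectMatchings (TwelveTwelve.RC n m) = 2 ^ (m * n + m + 1) ∧
      numPerfectMatchings (TwelveTwelve.RF n m) = 2 ^ (m * n)) ∧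
    HasEntropy TwelveTwelve.RT (1 / 3 * Real.log 2) ∧
    HasEntropy TwelveTwelve.RC (1 / 3 * Real.log 2) ∧
    HasEntropy TwelveTwelve.RF (1 / 3 * Real.log 2) := by
  open TwelveTwelve in
  refine ⟨fun n m => ⟨numPerfectMatchings_RT, numPerfectMatchings_RC, numPerfectMatchings_RF⟩,
    hasEntropy_of_eq_two_pow 1 1 2 fun n m => ?_, hasEntropy_of_eq_two_pow 1 0 1 fun n m => ?_,
    hasEntropy_of_eq_two_pow 0 0 0 fun n m => ?_⟩
  · simp only [numPerfectMatchings_RT, one_mul]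
  · simp only [numPerfectMatchings_RC, one_mul, zero_mul, add_zero]
  · simp only [numPerfectMatchings_RF, zero_mul, add_zero]
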